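/- All graphs are finite and simple. A subtree of an edge-coloured graph is *proper* if any two adjacent edges of it have different colours. A $3$-proper colouring of a connected graph $G$ is a colouring $E(G)\to\{1,\dots,t\}$ (adjacent edges may receive the same colour) such that every set of exactly three vertices of $G$ is contained in some proper tree of $G$; $px_3(G)$ is the smallest $t$ for which such a colouring exists. (If $G$ has fewer than three vertices the condition on triples is void, so $px_3(K_1)=0$ and $px_3(K_2)=1$.) A set $D\subseteq V(G)$ is a *connected $3$-way dominating set* of $G$ if every vertex outside $D$ has a neighbour in $D$, every vertex outside $D$ has degree at least $3$ in $G$, and the induced subgraph $G[D]$ is connected (in particular $D\neq\emptyset$). **Theorem.** If $D$ is a connected $3$-way dominating set of a connected graph $G$, then $px_3(G)\le px_3(G[D])+3$. Moreover, this bound is tight: let $p\ge 3$ and $i_1,\dots,i_p\ge 4$, and let $G$ be the graph formed by $p$ complete graphs $K_{i_1},\dots,K_{i_p}$ that have exactly one vertex $v_0$ in common. Then $G$ is connected, $\{v_0\}$ is a connected $3$-way dominating set of $G$, $px_3(G[\{v_0\}])=0$ and $px_3(G)=3$. -/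

import Mathlib

namespace ProperIndex

universe u v

/-- A subgraph `T` of an edge-coloured graph `G` is a proper tree: it is a tree, and any two
distinct edges of `T` which share an endpoint have different colours. -/
def IsProperTree {V : Type u} {G : SimpleGraph V} {K : Type v} (c : G.EdgeLabeling K)
    (T : G.Subgraph) : Prop :=
  T.coe.IsTree ∧
    ∀ (x y z : V) (hy : T.Adj x y) (hz : T.Adj x z), y ≠ z →
      c.get x y hy.adj_sub ≠ c.get x z hz.adj_sub

/-- `c` is a `k`-proper colouring: every set `S` of exactly `k` vertices is contained in the vertex
set of a proper tree of `G`. -/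
def IsKProperColoring {V : Type u} {G : SimpleGraph V} {K : Type v} (k : ℕ)
    (c : G.EdgeLabeling K) : Prop :=
  ∀ S : Finset V, S.card = k → ∃ T : G.Subgraph, (S : Set V) ⊆ T.verts ∧ IsProperTree c T

/-- The `k`-proper index `px_k(G)`: the least `t` such that `G` has a `k`-proper colouring
`E(G) → {1, …, t}`. For a finite connected graph such a `t` exists, see
`exists_isKProperColoring`, so this is a minimum. -/
noncomputable def properIndex {V : Type u} (k : ℕ) (G : SimpleGraph V) : ℕ :=
  sInf {t : ℕ | ∃ c : G.EdgeLabeling (Fin t), IsKProperColoring k c}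

/-- Every finite connected graph has a `k`-proper colouring with finitely many colours. -/
theorem exists_isKProperColoring {V : Type u} [Finite V] (k : ℕ) {G : SimpleGraph V}
    (hG : G.Connected) :
    {t : ℕ | ∃ c : G.EdgeLabeling (Fin t), IsKProperColoring k c}.Nonempty := by
  obtain ⟨F, hF, hT⟩ := hG.exists_isTree_le
  obtain ⟨t, ⟨e⟩⟩ := Finite.exists_equiv_fin G.edgeSet
  refine ⟨t, fun x => e x, fun S _ => ⟨SimpleGraph.toSubgraph F hF, by simp, ?_, ?_⟩⟩
  · have hs : (SimpleGraph.toSubgraph F hF).IsSpanning := SimpleGraph.toSubgraph.isSpanning F hF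
    exact ((SimpleGraph.Subgraph.spanningCoeEquivCoeOfSpanning _ hs).isTree_iff).1
      (show F.IsTree from hT)
  · intro x y z hy hz hne h
    have h' : s(x, y) = s(x, z) := congrArg Subtype.val (e.injective h)
    simp only [Sym2.eq_iff] at h'
    rcases h' with ⟨_, h'⟩ | ⟨h1, h2⟩
    · exact hne h'
    · exact hne (h2.trans h1)

/-- `D` is a dominating set: every vertex outside `D` has a neighbour in `D`. -/
def IsDominating {V : Type u} (G : SimpleGraph V) (D : Set V) : Prop :=
  ∀ x ∉ D, ∃ y ∈ D, G.Adj x y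

/-- `D` is a connected `s`-way dominating set: `D` is dominating, every vertex outside `D` has
degree at least `s` in `G`, and the induced subgraph `G[D]` is connected (hence nonempty). -/
structure IsConnectedWayDominating {V : Type u} (s : ℕ) (G : SimpleGraph V) (D : Set V) :
    Prop where
  dominating : IsDominating G D
  degree_ge : ∀ x ∉ D, (s : ℕ∞) ≤ (G.neighborSet x).encard
  connected : (G.induce D).Connected

/-- The vertices of `p` complete graphs `K_{i 0}, …, K_{i (p-1)}` glued at one vertex: the shared
vertex is `none`, and the `j`-th complete graph has `i j - 1` further vertices `some ⟨j, a⟩`. -/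
abbrev CliqueUnionVertex {p : ℕ} (i : Fin p → ℕ) : Type :=
  Option (Σ j : Fin p, Fin (i j - 1))

/-- The vertex set of the `j`-th complete graph. -/
def cliquePart {p : ℕ} (i : Fin p → ℕ) (j : Fin p) : Set (CliqueUnionVertex i) :=
  {x | x = none ∨ ∃ a : Fin (i j - 1), x = some ⟨j, a⟩}

/-- The graph obtained from `p` complete graphs `K_{i 0}, …, K_{i (p-1)}` with exactly one vertex
in common: two vertices are adjacent if they are distinct and lie in the same complete graph. -/
def cliqueUnion {p : ℕ} (i : Fin p → ℕ) : SimpleGraph (CliqueUnionVertex i) where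
  Adj x y := x ≠ y ∧ ∃ j : Fin p, x ∈ cliquePart i j ∧ y ∈ cliquePart i j
  symm := ⟨fun _ _ ⟨hne, j, hx, hy⟩ => ⟨hne.symm, j, hy, hx⟩⟩
  loopless := ⟨fun _ h => h.1 rfl⟩

end ProperIndex

open SimpleGraph

namespace ProperIndex

universe u v

/-! ### Subtrees: attaching a pendant edge, passing from `G[D]` to `G`, small vertex sets. -/

section Trees

variable {V : Type u} {G : SimpleGraph V}

/-! Three new colours, the elements of `ZMod 3`, are used on all edges not inside `D`. A triple `S`
is caught by a proper tree of `G[D]` together with disjoint properly coloured paths outside `D`,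
each continued into `D` by one edge, its leg. Legs of different paths have different colours, so
their feet in `D` may coincide. There is at most one path per vertex of `S` outside `D`, so the tree
of `G[D]` has to contain at most three prescribed vertices (`exists_attach_list`,
`exists_properColoring_of_dominating`).

It remains to colour so that such paths exist. A vertex `x` outside `D` gets a colour `f x`, and a
leg of that colour; an outer edge `xy` gets `-(f x + f y)`, the third colour if `f x ≠ f y` and the
common colour otherwise. Hence `x` can also enter by the leg of a differently coloured neighbour.
Vertices of different colours use their own legs; conflicts arise only between vertices of equal
colour (`exists_entries`). To resolve them, `f` is a level function modulo 3 of maximal sum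
(`exists_levels`): most vertices then see both other colours, and the exceptions, some roots and
some vertices with only lower neighbours, start paths of length two that serve instead
(`flexible_or`, `exists_entry_coloring`). Degree at least three supplies either extra legs or two
outer neighbours (`exists_leg_coloring`).

For the glued cliques, a tree through vertices of three different cliques has three edges at the
common vertex, which forces three colours. -/

theorem subgraph_isTree_iff [Finite V] (T : G.Subgraph) :
    T.coe.IsTree ↔ T.Connected ∧ T.edgeSet.ncard + 1 = T.verts.ncard := by
  have h : Nat.card T.coe.edgeSet = T.edgeSet.ncard := by
    rw [← Subgraph.image_coe_edgeSet_coe, Set.ncard_image_of_injective _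
      (Sym2.map.injective Subtype.val_injective)]
    rfl
  rw [isTree_iff_connected_and_card, h, Subgraph.connected_iff', Set.ncard_def]
  rfl

/-- Attaching a new vertex to a tree by one edge gives a tree. -/
theorem isTree_sup_subgraphOfAdj [Finite V] {T : G.Subgraph} (hT : T.coe.IsTree) {u w : V}
    (hu : u ∈ T.verts) (hw : w ∉ T.verts) (h : G.Adj u w) :
    (T ⊔ G.subgraphOfAdj h).coe.IsTree := by
  rw [subgraph_isTree_iff] at hT ⊢
  refine ⟨Subgraph.connected_sup hT.1.preconnected (Subgraph.subgraphOfAdj_connected h).preconnected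
    ⟨u, hu, by simp⟩, ?_⟩
  have h1 : (T ⊔ G.subgraphOfAdj h).edgeSet = insert s(u, w) T.edgeSet := by
    rw [Subgraph.edgeSet_sup, edgeSet_subgraphOfAdj, Set.union_comm, Set.singleton_union]
  have h2 : (T ⊔ G.subgraphOfAdj h).verts = insert w T.verts := by
    rw [Subgraph.verts_sup, subgraphOfAdj_verts]
    grind
  have h3 : s(u, w) ∉ T.edgeSet := fun h' => hw (T.edge_vert (T.symm.symm _ _ h'))
  rw [h1, h2, Set.ncard_insert_of_notMem h3 (Set.toFinite _),
    Set.ncard_insert_of_notMem hw (Set.toFinite _), hT.2]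

theorem isProperTree_sup_subgraphOfAdj [Finite V] {K : Type v} {c : G.EdgeLabeling K}
    {T : G.Subgraph} (hT : IsProperTree c T) {u w : V} (hu : u ∈ T.verts) (hw : w ∉ T.verts)
    (h : G.Adj u w) (hc : ∀ z (hz : T.Adj u z), c.get u z hz.adj_sub ≠ c.get u w h) :
    IsProperTree c (T ⊔ G.subgraphOfAdj h) := by
  refine ⟨isTree_sup_subgraphOfAdj hT.1 hu hw h, ?_⟩
  have key : ∀ x y z (hy : T.Adj x y) (hz : (G.subgraphOfAdj h).Adj x z),
      c.get x y hy.adj_sub ≠ c.get x z hz.adj_sub := by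
    intro x y z hy hz
    have hx : x ∈ T.verts := T.edge_vert hy
    rw [subgraphOfAdj_adj, Sym2.eq_iff] at hz
    obtain ⟨rfl, rfl⟩ | ⟨rfl, rfl⟩ := hz
    · exact hc _ hy
    · exact absurd hx hw
  intro x y z hy hz hne
  rcases hy with hy | hy <;> rcases hz with hz | hz
  · exact hT.2 x y z hy hz hne
  · exact key x y z hy hz
  · exact (key x z y hz hy).symm
  · rw [subgraphOfAdj_adj, Sym2.eq_iff] at hy hz
    grind [h.ne]

theorem isTree_map_induce [Finite V] (D : Set V) (T : (G.induce D).Subgraph)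
    (hT : T.coe.IsTree) : (T.map (Embedding.induce D).toHom).coe.IsTree := by
  have hinj : Function.Injective (Embedding.induce (G := G) D).toHom := Subtype.val_injective
  rw [subgraph_isTree_iff] at hT ⊢
  have hconn : (T.map (Embedding.induce D).toHom).Connected := by
    rw [Subgraph.connected_iff']
    refine Connected.map (G := T.coe) ⟨fun x => ⟨_, Set.mem_image_of_mem _ x.2⟩,
      fun {x y} h => ⟨x, y, h, rfl, rfl⟩⟩ ?_ hT.1.coe
    rintro ⟨_, x, hx, rfl⟩
    exact ⟨⟨x, hx⟩, rfl⟩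
  refine ⟨hconn, ?_⟩
  rw [Subgraph.edgeSet_map, Subgraph.map_verts,
    Set.ncard_image_of_injective _ (Sym2.map.injective hinj),
    Set.ncard_image_of_injective _ hinj, hT.2]

/-- A small set of vertices of a finite connected graph lies in a proper tree, for any
`k`-proper colouring with `k ≤ 3`. -/
theorem exists_properTree_of_card_le [Finite V] (hG : G.Connected) {k : ℕ} (hk : k ≤ 3)
    {K : Type v} {c : G.EdgeLabeling K} (hc : IsKProperColoring k c) (S : Finset V) (hS : S.card ≤ k) :
    ∃ T : G.Subgraph, (S : Set V) ⊆ T.verts ∧ IsProperTree c T := by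
  classical
  have := Fintype.ofFinite V
  by_cases hV : k ≤ Fintype.card V
  · obtain ⟨S', hS', hcard⟩ := Finset.exists_superset_card_eq hS hV
    obtain ⟨T, hT, hT'⟩ := hc S' hcard
    exact ⟨T, (Finset.coe_subset.2 hS').trans hT, hT'⟩
  -- With fewer than three vertices no two distinct edges meet, so any spanning tree is proper.
  · obtain ⟨F, hF, hT⟩ := hG.exists_isTree_le
    refine ⟨SimpleGraph.toSubgraph F hF, by simp, ?_, ?_⟩
    · have hs : (SimpleGraph.toSubgraph F hF).IsSpanning := SimpleGraph.toSubgraph.isSpanning F hF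
      exact ((SimpleGraph.Subgraph.spanningCoeEquivCoeOfSpanning _ hs).isTree_iff).1
        (show F.IsTree from hT)
    · intro x y z hy hz hne
      exfalso
      have h3 : ({x, y, z} : Finset V).card = 3 := by
        rw [Finset.card_eq_three]
        exact ⟨x, y, z, hy.adj_sub.ne, hz.adj_sub.ne, hne, rfl⟩
      have := Finset.card_le_univ ({x, y, z} : Finset V)
      omega

theorem properIndex_le_of_card [Finite V] {k : ℕ} {K : Type v} [Fintype K]
    {c : G.EdgeLabeling K} (hc : IsKProperColoring k c) :
    properIndex k G ≤ Fintype.card K := by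
  refine Nat.sInf_le ⟨c.compRight (Fintype.equivFin K), fun S hS => ?_⟩
  obtain ⟨T, hT, ht, hp⟩ := hc S hS
  refine ⟨T, hT, ht, fun x y z hy hz hne h => hp x y z hy hz hne ?_⟩
  exact (Fintype.equivFin K).injective h

end Trees

/-! ### Level functions of maximal sum. -/

section Levels

variable {V : Type u}

/-- A level function with root map: levels are attained stepwise, and the vertices of level `0` are
the chosen representatives of the components. -/
structure IsLevel (H : SimpleGraph V) (r : H.ConnectedComponent → V) (d : V → ℕ) : Prop where
  zero_iff : ∀ x, d x = 0 ↔ x = r (H.connectedComponentMk x)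
  exists_lower : ∀ x n, d x = n + 1 → ∃ y, H.Adj x y ∧ d y = n

variable {H : SimpleGraph V} {r : H.ConnectedComponent → V} {d : V → ℕ}

theorem IsLevel.exists_of_le (hd : IsLevel H r d) {x : V} {m : ℕ} (hm : m ≤ d x) :
    ∃ y, H.connectedComponentMk y = H.connectedComponentMk x ∧ d y = m := by
  obtain ⟨k, hk⟩ := Nat.exists_eq_add_of_le hm
  clear hm
  induction k generalizing x with
  | zero => exact ⟨x, rfl, by omega⟩
  | succ k ih =>
    obtain ⟨y, hxy, hy⟩ := hd.exists_lower x (m + k) (by omega)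
    obtain ⟨z, hz, hzm⟩ := ih hy
    exact ⟨z, hz.trans (ConnectedComponent.sound hxy.symm.reachable), hzm⟩

theorem IsLevel.eq_of_zero (hd : IsLevel H r d) {x y : V}
    (h : H.connectedComponentMk x = H.connectedComponentMk y) (hx : d x = 0) (hy : d y = 0) :
    x = y := by
  rw [hd.zero_iff] at hx hy
  rw [hx, h, ← hy]

/-- All levels up to `d x` are attained. The bound leaves only finitely many level functions, so
that one of maximal sum exists. -/
theorem IsLevel.lt_card [Finite V] (hd : IsLevel H r d) (x : V) : d x < Nat.card V := by
  have key : ∀ m : Fin (d x + 1), ∃ y, d y = m := fun m =>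
    (hd.exists_of_le (Nat.lt_succ_iff.1 m.2)).imp fun _ h => h.2
  choose g hg using key
  have hinj : Function.Injective g := by
    intro m m' h
    have := congrArg d h
    rw [hg, hg] at this
    exact Fin.ext this
  simpa using Nat.card_le_card_of_injective _ hinj

theorem isLevel_dist (hr : ∀ C, H.connectedComponentMk (r C) = C) :
    IsLevel H r fun x => H.dist (r (H.connectedComponentMk x)) x := by
  have hreach : ∀ x, H.Reachable (r (H.connectedComponentMk x)) x := fun x =>
    ConnectedComponent.exact (hr _)
  refine ⟨fun x => ?_, fun x n hn => ?_⟩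
  · rw [(hreach x).dist_eq_zero_iff, eq_comm]
  · obtain ⟨p, hp⟩ := (hreach x).symm.exists_walk_length_eq_dist
    have hcomp : ∀ y, H.Adj x y → H.connectedComponentMk y = H.connectedComponentMk x :=
      fun y h => ConnectedComponent.sound h.symm.reachable
    beta_reduce at *
    suffices ∃ y, H.Adj x y ∧ H.dist (r (H.connectedComponentMk x)) y = n by
      obtain ⟨y, h, hy⟩ := this
      exact ⟨y, h, by rw [hcomp y h, hy]⟩
    clear hcomp
    have hr' := hreach x
    generalize r (H.connectedComponentMk x) = ρ at *
    cases p with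
    | nil => simp at hn
    | @cons _ y _ h q =>
      refine ⟨y, h, ?_⟩
      have h1 := dist_le q
      rw [Walk.length_cons, dist_comm, hn] at hp
      rw [dist_comm] at h1
      obtain ⟨q', hq'⟩ := (hr'.trans h.reachable).exists_walk_length_eq_dist
      have h2 := dist_le (q'.append (Walk.cons h.symm Walk.nil))
      rw [Walk.length_append, Walk.length_cons, Walk.length_nil] at h2
      omega

/-- Take a level function of maximal sum. If `x` has no neighbour one level up, no vertex needs `x`
as its lower neighbour, so `x` could be raised above any neighbour that is not below it. -/
theorem IsLevel.exists_maximal [Finite V] (hr : ∀ C, H.connectedComponentMk (r C) = C) :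
    ∃ d, IsLevel H r d ∧
      ∀ x, (∃ y, H.Adj x y ∧ d y = d x + 1) ∨ ∀ y, H.Adj x y → d y < d x := by
  classical
  have := Fintype.ofFinite V
  have hfin : {d : V → ℕ | IsLevel H r d}.Finite := by
    refine (Set.Finite.pi' (t := fun _ : V => Set.Iio (Nat.card V))
      fun _ => Set.finite_Iio _).subset ?_
    intro d hd x
    exact hd.lt_card x
  obtain ⟨d, hd, hmax⟩ := Set.exists_max_image _ (fun d : V → ℕ => ∑ x, d x) hfin
    ⟨_, isLevel_dist hr⟩
  refine ⟨d, hd, fun x => ?_⟩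
  by_contra! hcon
  obtain ⟨hup, y, hxy, hle⟩ := hcon
  have hd : IsLevel H r d := hd
  -- The root cannot be raised, but it has an upper neighbour as soon as it has any: the component
  -- then has a vertex of level 1, whose lower neighbour is the root.
  have hx0 : d x ≠ 0 := by
    intro h0
    have hy0 : d y ≠ 0 := fun h1 =>
      hxy.ne (hd.eq_of_zero (ConnectedComponent.sound hxy.reachable) h0 h1)
    obtain ⟨z, hz, hz1⟩ := hd.exists_of_le (Nat.one_le_iff_ne_zero.2 hy0)
    obtain ⟨w, hzw, hw⟩ := hd.exists_lower z 0 hz1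
    have hwx : w = x := hd.eq_of_zero ((ConnectedComponent.sound hzw.symm.reachable).trans
      (hz.trans (ConnectedComponent.sound hxy.symm.reachable))) hw h0
    subst hwx
    exact hup z hzw.symm (by omega)
  have hlev : IsLevel H r (Function.update d x (d y + 1)) := by
    refine ⟨fun z => ?_, fun z n hn => ?_⟩
    · by_cases hz : z = x
      · subst hz
        rw [Function.update_self, ← hd.zero_iff]
        simp [hx0]
      · rw [Function.update_of_ne hz, hd.zero_iff]
    · by_cases hz : z = x
      · subst hz
        rw [Function.update_self] at hn
        exact ⟨y, hxy, by rw [Function.update_of_ne hxy.ne']; omega⟩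
      · rw [Function.update_of_ne hz] at hn
        obtain ⟨w, hw, hwn⟩ := hd.exists_lower z n hn
        refine ⟨w, hw, ?_⟩
        rw [Function.update_of_ne, hwn]
        rintro rfl
        exact hup z hw.symm (by omega)
  have hlt : ∑ z, d z < ∑ z, Function.update d x (d y + 1) z := by
    refine Finset.sum_lt_sum (fun z _ => ?_) ⟨x, Finset.mem_univ _, ?_⟩
    · by_cases hz : z = x
      · subst hz; rw [Function.update_self]; omega
      · rw [Function.update_of_ne hz]
    · rw [Function.update_self]; omega
  exact absurd (hmax _ hlev) (by simpa using hlt)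

/-- If a vertex has two neighbours, either of them starts a path of length two and can serve as
root. This excludes a root at the centre of a star with several leaves, where level 2 would be
missing. -/
theorem exists_mem_component_root (C : H.ConnectedComponent) :
    ∃ x, H.connectedComponentMk x = C ∧ ((∀ y z, H.Adj x y → H.Adj x z → y = z) ∨
      ∃ y z, H.Adj x y ∧ H.Adj y z ∧ z ≠ x) := by
  obtain ⟨x, rfl⟩ := C.exists_rep
  by_cases h : ∀ y z, H.Adj x y → H.Adj x z → y = z
  · exact ⟨x, rfl, Or.inl h⟩
  · push Not at h
    obtain ⟨y, z, hy, hz, hne⟩ := h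
    exact ⟨y, ConnectedComponent.sound hy.symm.reachable, Or.inr ⟨x, z, hy.symm, hz, hne.symm⟩⟩

/-- Levels on a finite graph such that a vertex without a neighbour one level up has only
neighbours of lower level. -/
theorem exists_levels (H : SimpleGraph V) [Finite V] : ∃ d : V → ℕ,
    (∀ x n, d x = n + 1 → ∃ y, H.Adj x y ∧ d y = n) ∧
    (∀ x, (∃ y, H.Adj x y ∧ d y = d x + 1) ∨ ∀ y, H.Adj x y → d y < d x) ∧
    (∀ x y, H.Reachable x y → d x = 0 → d y = 0 → x = y) ∧
    ∀ x y z, d x = 0 → H.Adj x y → H.Adj x z → y ≠ z →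
      ∃ u w, H.Adj x u ∧ H.Adj u w ∧ d u = 1 ∧ d w = 2 := by
  choose r hr hr' using exists_mem_component_root (H := H)
  obtain ⟨d, hd, hmax⟩ := IsLevel.exists_maximal hr
  refine ⟨d, hd.exists_lower, hmax, fun x y h => hd.eq_of_zero (ConnectedComponent.sound h), ?_⟩
  intro x y z hx hy hz hne
  have hxr := (hd.zero_iff x).1 hx
  obtain h | ⟨v, w, hv, hvw, hwx⟩ := hr' (H.connectedComponentMk x)
  · rw [← hxr] at h
    exact absurd (h y z hy hz) hne
  rw [← hxr] at hv hwx
  have hcv : H.connectedComponentMk v = H.connectedComponentMk x :=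
    ConnectedComponent.sound hv.symm.reachable
  have hcw : H.connectedComponentMk w = H.connectedComponentMk x :=
    (ConnectedComponent.sound hvw.symm.reachable).trans hcv
  have hv0 : d v ≠ 0 := fun h => hv.ne (hd.eq_of_zero hcv h hx).symm
  have hw0 : d w ≠ 0 := fun h => hwx (hd.eq_of_zero hcw h hx)
  -- If `v` and `w` both had level 1, then `v` would have a neighbour `w` that is not lower, so by
  -- maximality also one of level 2.
  obtain ⟨t, ht, htd⟩ : ∃ t, H.connectedComponentMk t = H.connectedComponentMk x ∧ 2 ≤ d t := by
    by_cases h2 : 2 ≤ d v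
    · exact ⟨v, hcv, h2⟩
    by_cases h3 : 2 ≤ d w
    · exact ⟨w, hcw, h3⟩
    obtain ⟨t, hvt, ht⟩ | h := hmax v
    · exact ⟨t, (ConnectedComponent.sound hvt.symm.reachable).trans hcv, by omega⟩
    · have := h w hvw
      omega
  obtain ⟨w', hw', hw2⟩ := hd.exists_of_le htd
  obtain ⟨u, hu, hu1⟩ := hd.exists_lower w' 1 hw2
  obtain ⟨x', hx', hx0⟩ := hd.exists_lower u 0 hu1
  have : x' = x := hd.eq_of_zero ((ConnectedComponent.sound hx'.symm.reachable).trans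
    ((ConnectedComponent.sound hu.symm.reachable).trans (hw'.trans ht))) hx0 hx
  subst this
  exact ⟨u, w', hx'.symm, hu.symm, hu1, hw2⟩

end Levels

/-! ### Disjoint properly coloured paths ending in legs. -/

section Entries

variable {W : Type u}

/-- `Entry H f L x e t P`: there is a path in `H` on the vertex set `P` which starts at `x` and is
continued by a leg of colour `t` at its last vertex, properly coloured when an edge `yz` of `H` has
the colour `-(f y + f z)`. The first edge has colour `e`, and `L y t` says that `y` has a leg of
colour `t`. -/
inductive Entry (H : SimpleGraph W) (f : W → ZMod 3) (L : W → ZMod 3 → Prop) :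
    W → ZMod 3 → ZMod 3 → Set W → Prop
  | leg {x : W} {t : ZMod 3} (h : L x t) : Entry H f L x t t {x}
  | step {x y : W} {e t : ZMod 3} {P : Set W} (h : H.Adj x y) (hy : Entry H f L y e t P)
      (hx : x ∉ P) (he : -(f x + f y) ≠ e) : Entry H f L x (-(f x + f y)) t (insert x P)

/-- `x` can be joined to the outside by a leg of colour `t`, along a path with vertex set `P`. -/
def Enters (H : SimpleGraph W) (f : W → ZMod 3) (L : W → ZMod 3 → Prop) (x : W) (t : ZMod 3)
    (P : Set W) : Prop :=
  ∃ e, Entry H f L x e t P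

variable {H : SimpleGraph W} {f : W → ZMod 3} {L : W → ZMod 3 → Prop}

theorem Enters.mem {x : W} {t : ZMod 3} {P : Set W} (h : Enters H f L x t P) : x ∈ P := by
  obtain ⟨e, h⟩ := h
  cases h <;> simp

theorem enters_leg {x : W} {t : ZMod 3} (h : L x t) : Enters H f L x t {x} := ⟨_, .leg h⟩

theorem enters_step (hL : ∀ x, L x (f x)) {x y : W} (h : H.Adj x y) (hne : f y ≠ f x) :
    Enters H f L x (f y) {x, y} := by
  refine ⟨_, .step h (.leg (hL y)) (by simpa using h.ne) ?_⟩
  generalize f x = a at *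
  generalize f y = b at *
  decide +revert

/-- The case `f x = f y` is allowed: `xy` then has the colour `f x`, and `yz` has the colour
different from both `f x` and `f z`. -/
theorem enters_step_step (hL : ∀ x, L x (f x)) {x y z : W} (h : H.Adj x y) (h' : H.Adj y z)
    (hzy : f z ≠ f y) (hzx : f z ≠ f x) :
    Enters H f L x (f z) {x, y, z} := by
  have hxz : x ≠ z := fun h => hzx (by rw [h])
  refine ⟨_, .step h (.step h' (.leg (hL z)) (by simpa using h'.ne) ?_)
    (by simpa using ⟨h.ne, hxz⟩) ?_⟩
  all_goals
    generalize f x = a at *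
    generalize f y = b at *
    generalize f z = c at *
    decide +revert

/-- For each colour other than its own, `x` has a leg or a neighbour of that colour. -/
def Flexible (H : SimpleGraph W) (f : W → ZMod 3) (L : W → ZMod 3 → Prop) (x : W) : Prop :=
  ∀ t, t ≠ f x → L x t ∨ ∃ y, H.Adj x y ∧ f y = t

theorem Flexible.enters (hL : ∀ x, L x (f x)) {x : W} (h : Flexible H f L x) {t : ZMod 3}
    (ht : t ≠ f x) : ∃ P, Enters H f L x t P ∧ ∀ z ∈ P, z = x ∨ f z = t := by
  obtain h | ⟨y, hy, rfl⟩ := h t ht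
  · exact ⟨_, enters_leg h, by simp⟩
  · exact ⟨_, enters_step hL hy ht, by grind⟩

theorem ZMod.eq_add_or_sub {a b : ZMod 3} (h : a ≠ b) : a = b + 1 ∨ a = b - 1 := by
  decide +revert

theorem ZMod.eq_three_cases (a b : ZMod 3) : a = b ∨ a = b + 1 ∨ a = b - 1 := by
  decide +revert

theorem ZMod.add_one_ne (a : ZMod 3) : a + 1 ≠ a ∧ a - 1 ≠ a ∧ a + 1 ≠ a - 1 := by
  decide +revert

/-- The two ways in which a vertex can fail to be flexible, for the colouring by levels
modulo `3`. -/
theorem flexible_or {d : W → ℕ} (hf : ∀ x, f x = d x)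
    (hlow : ∀ x n, d x = n + 1 → ∃ y, H.Adj x y ∧ d y = n)
    (htop : ∀ x, (∃ y, H.Adj x y ∧ d y = d x + 1) ∨ ∀ y, H.Adj x y → d y < d x)
    (huniq : ∀ x y, H.Reachable x y → d x = 0 → d y = 0 → x = y)
    (hroot : ∀ x y z, d x = 0 → H.Adj x y → H.Adj x z → y ≠ z →
      ∃ u w, H.Adj x u ∧ H.Adj u w ∧ d u = 1 ∧ d w = 2)
    {s : W → ZMod 3} (hs : ∀ x, (∃ y, H.Adj x y ∧ d y = d x + 1) → s x = f x - 1)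
    (hs' : ∀ x, (¬ ∃ y, H.Adj x y ∧ d y = d x + 1) → s x = f x + 1) (x : W)
    (hx : (∀ t, L x t) ∨ (L x (s x) ∧ ∃ y, H.Adj x y) ∨
      ∃ y z, H.Adj x y ∧ H.Adj x z ∧ y ≠ z) :
    Flexible H f L x ∨
    (d x = 0 ∧ ∃ u w, H.Adj x u ∧ H.Adj u w ∧ d u = 1 ∧ f u = f x + 1 ∧ f w = f x - 1) ∨
    ((∀ y, H.Adj x y → d y < d x) ∧ ∃ p g q, H.Adj x p ∧ H.Adj p g ∧ H.Adj x q ∧ q ≠ p ∧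
      f p = f x - 1 ∧ f g = f x + 1 ∧
      (f q = f x - 1 ∨ f q = f x ∧ ∃ q', H.Adj q q' ∧ f q' = f x + 1 ∧ d q < d x)) := by
  have h3 : (3 : ZMod 3) = 0 := rfl
  have hsucc : ∀ y z, d z = d y + 1 → f z = f y + 1 := fun y z h => by simp [hf, h]
  have hflex : (L x (f x + 1) ∨ ∃ y, H.Adj x y ∧ f y = f x + 1) →
      (L x (f x - 1) ∨ ∃ y, H.Adj x y ∧ f y = f x - 1) → Flexible H f L x := by
    intro h h' t ht
    obtain rfl | rfl := ZMod.eq_add_or_sub ht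
    exacts [h, h']
  obtain hall | hx := hx
  · exact Or.inl fun t _ => Or.inl (hall t)
  have hlower : ∀ n, d x = n + 1 → ∃ p, H.Adj x p ∧ d p = n ∧ f p = f x - 1 := by
    intro n hn
    obtain ⟨p, hp, hpn⟩ := hlow x n hn
    exact ⟨p, hp, hpn, by rw [hsucc p x (by omega)]; ring⟩
  obtain ⟨y, hy, hyd⟩ | ht := htop x
  · obtain hx0 | ⟨n, hn⟩ : d x = 0 ∨ ∃ n, d x = n + 1 := by cases d x <;> simp
    · obtain ⟨hl, -⟩ | ⟨y', z, hy', hz, hne⟩ := hx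
      · rw [hs x ⟨y, hy, hyd⟩] at hl
        exact Or.inl (hflex (Or.inr ⟨y, hy, hsucc _ _ hyd⟩) (Or.inl hl))
      · obtain ⟨u, w, hu, hw, hu1, hw2⟩ := hroot x y' z hx0 hy' hz hne
        have hfu := hsucc x u (by omega)
        have hfw := hsucc u w (by omega)
        refine Or.inr (Or.inl ⟨hx0, u, w, hu, hw, hu1, hfu, ?_⟩)
        rw [hfw, hfu]
        linear_combination h3
    · obtain ⟨p, hp, -, hfp⟩ := hlower _ hn
      exact Or.inl (hflex (Or.inr ⟨y, hy, hsucc _ _ hyd⟩) (Or.inr ⟨p, hp, hfp⟩))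
  · have hnup : ¬ ∃ y, H.Adj x y ∧ d y = d x + 1 := by
      rintro ⟨y, hy, hyd⟩
      have := ht y hy
      omega
    have hpos : ∀ y, H.Adj x y → ∃ n, d x = n + 1 := fun y hy =>
      ⟨d x - 1, by have := ht y hy; omega⟩
    obtain ⟨hl, y, hy⟩ | ⟨y, z, hy, hz, hne⟩ := hx
    · rw [hs' x hnup] at hl
      obtain ⟨n, hn⟩ := hpos y hy
      obtain ⟨p, hp, -, hfp⟩ := hlower n hn
      exact Or.inl (hflex (Or.inl hl) (Or.inr ⟨p, hp, hfp⟩))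
    · obtain ⟨n, hn⟩ := hpos y hy
      obtain ⟨p, hp, hpn, hfp⟩ := hlower n hn
      obtain ⟨q, hq, hqp⟩ : ∃ q, H.Adj x q ∧ q ≠ p := by
        by_cases h : y = p
        · exact ⟨z, hz, fun h' => hne (h.trans h'.symm)⟩
        · exact ⟨y, hy, h⟩
      have hqd := ht q hq
      -- At level 1 both `p` and `q` would be the root; hence `p` has a lower neighbour `g`.
      obtain _ | m := n
      · exact absurd (huniq q p (hq.symm.reachable.trans hp.reachable) (by omega) hpn) hqp
      obtain ⟨g, hg, hgm⟩ := hlow p m hpn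
      have hfg : f g = f x + 1 := by
        have := hsucc g p (by omega)
        linear_combination hfp - this - h3
      obtain h | h | h := ZMod.eq_three_cases (f q) (f x)
      -- `q` has the higher neighbour `x`, so maximality gives it a neighbour exactly one level up.
      · obtain ⟨q', hq', hqd'⟩ | h' := htop q
        · exact Or.inr (Or.inr ⟨ht, p, g, q, hp, hg, hq, hqp, hfp, hfg,
            Or.inr ⟨h, q', hq', by rw [hsucc _ _ hqd', h], hqd⟩⟩)
        · have := h' x hq.symm
          omega
      · exact Or.inl (hflex (Or.inr ⟨q, hq, h⟩) (Or.inr ⟨p, hp, hfp⟩))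
      · exact Or.inr (Or.inr ⟨ht, p, g, q, hp, hg, hq, hqp, hfp, hfg, Or.inl h⟩)

theorem enters_of_chain (hL : ∀ x, L x (f x)) {x u w : W} (hu : H.Adj x u) (hw : H.Adj u w)
    (hux : f u ≠ f x) (hwx : f w ≠ f x) (hwu : f w ≠ f u) {t : ZMod 3} (ht : t ≠ f x) :
    ∃ P, Enters H f L x t P ∧ ∀ z ∈ P, f z = f x → z = x := by
  by_cases h : t = f u
  · subst h
    exact ⟨_, enters_step hL hu hux, by grind⟩
  · have h' : t = f w := by
      generalize f x = a at *
      generalize f u = b at *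
      generalize f w = c at *
      decide +revert
    subst h'
    exact ⟨_, enters_step_step hL hu hw hwu hwx, by grind⟩

/-- `x` and `y` can enter disjointly, by two colours other than that of `x`. -/
def EntersTwice (H : SimpleGraph W) (f : W → ZMod 3) (L : W → ZMod 3 → Prop) (x y : W) : Prop :=
  ∃ t₁ t₂ P Q, Enters H f L x t₁ P ∧ Enters H f L y t₂ Q ∧
    Disjoint P Q ∧ t₁ ≠ t₂ ∧ t₁ ≠ f x ∧ t₂ ≠ f x

theorem EntersTwice.symm {x y : W} (h : EntersTwice H f L x y) (hf : f x = f y) :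
    EntersTwice H f L y x := by
  obtain ⟨t₁, t₂, P, Q, h1, h2, h3, h4, h5, h6⟩ := h
  exact ⟨t₂, t₁, Q, P, h2, h1, h3.symm, h4.symm, hf ▸ h6, hf ▸ h5⟩

/-- Let `y` choose its colour `t` first; `x` takes the remaining one. Apart from their starting
points the two paths use vertices of different colours, so they cannot meet. -/
theorem Flexible.entersTwice (hL : ∀ x, L x (f x)) {x y : W} (hxy : x ≠ y) (hf : f x = f y)
    (hx : Flexible H f L x)
    (hy : ∃ t ≠ f y, ∃ P, Enters H f L y t P ∧ ∀ z ∈ P, z = y ∨ f z = t) :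
    EntersTwice H f L x y := by
  obtain ⟨t, ht, Q, hQ, hQ'⟩ := hy
  obtain ⟨t', ht', htt⟩ : ∃ t', t' ≠ f x ∧ t' ≠ t := by
    generalize f x = a
    clear * -
    decide +revert
  obtain ⟨P, hP, hP'⟩ := hx.enters hL ht'
  refine ⟨t', t, P, Q, hP, hQ, Set.disjoint_left.2 fun z hz hz' => ?_, htt, ht', by rwa [hf]⟩
  have := hP' z hz
  have := hQ' z hz'
  grind

/-- The paths are `x u w` and `y v`. The colour of `w` separates it from `x`, `y` and `v`, so only
`u` needs separate hypotheses; `f u = f x` is permitted. -/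
theorem entersTwice_of_chain (hL : ∀ x, L x (f x)) {x y u w v : W} (hxy : x ≠ y) (hf : f x = f y)
    (hu : H.Adj x u) (hw : H.Adj u w) (hv : H.Adj y v) (hvx : f v ≠ f x) (hwx : f w ≠ f x)
    (hwu : f w ≠ f u) (hwv : f w ≠ f v) (huv : u ≠ v) (huy : u ≠ y) : EntersTwice H f L x y := by
  refine ⟨f w, f v, _, _, enters_step_step hL hu hw hwu hwx,
    enters_step hL hv (hf ▸ hvx), ?_, hwv, hwx, hvx⟩
  rw [Set.disjoint_left]
  grind

theorem entersTwice_of_adj (hL : ∀ x, L x (f x)) {x y u v : W} (hxy : x ≠ y) (hf : f x = f y)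
    (hu : H.Adj x u) (hv : H.Adj y v) (hux : f u ≠ f x) (hvx : f v ≠ f x) (huv : f u ≠ f v) :
    EntersTwice H f L x y := by
  refine ⟨f u, f v, _, _, enters_step hL hu hux, enters_step hL hv (hf ▸ hvx), ?_, huv, hux, hvx⟩
  rw [Set.disjoint_left]
  grind

/-- A finite graph has a colouring of its vertices and a choice of a second colour for each vertex
such that, if every vertex has a leg of its own colour, and moreover legs of all colours, or one of
the second colour and a neighbour, or two neighbours, then each vertex can enter by any colour, and
two vertices of one colour can enter disjointly by the two other colours. -/
theorem exists_entry_coloring (H : SimpleGraph W) [Finite W] : ∃ f s : W → ZMod 3,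
    (∀ x, s x ≠ f x) ∧ ∀ L : W → ZMod 3 → Prop, (∀ x, L x (f x)) →
    (∀ x, (∀ t, L x t) ∨ (L x (s x) ∧ ∃ y, H.Adj x y) ∨ ∃ y z, H.Adj x y ∧ H.Adj x z ∧ y ≠ z) →
    (∀ x t, ∃ P, Enters H f L x t P ∧ ∀ z ∈ P, f z = f x → z = x) ∧
    ∀ x y, x ≠ y → f x = f y → EntersTwice H f L x y := by
  classical
  obtain ⟨d, hlow, htop, huniq, hroot⟩ := exists_levels H
  obtain ⟨f, hfd⟩ : ∃ f : W → ZMod 3, ∀ x, f x = d x := ⟨_, fun _ => rfl⟩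
  -- The second leg supplies what the neighbours may lack: a vertex with an upper neighbour already
  -- sees `f x + 1`, and a non-isolated vertex without one sees `f x - 1` below it.
  refine ⟨f, fun x => if ∃ y, H.Adj x y ∧ d y = d x + 1 then f x - 1 else f x + 1,
    fun x => ?_, fun L hL hx => ?_⟩
  · beta_reduce
    split_ifs
    exacts [(ZMod.add_one_ne _).2.1, (ZMod.add_one_ne _).1]
  have key := fun x => flexible_or hfd hlow htop huniq
    hroot (fun x h => if_pos h) (fun x h => if_neg h) x (hx x)
  clear hx hlow hroot htop
  obtain ⟨hn1, hn2, hn3⟩ : (∀ a : ZMod 3, a + 1 ≠ a) ∧ (∀ a : ZMod 3, a - 1 ≠ a) ∧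
    ∀ a : ZMod 3, a + 1 ≠ a - 1 := by decide
  constructor
  · intro x t
    by_cases ht : t = f x
    · exact ⟨{x}, enters_leg (ht ▸ hL x), by simp⟩
    obtain h | ⟨-, u, w, hu, hw, -, hfu, hfw⟩ | ⟨-, u, w, -, hu, hw, -, -, hfu, hfw, -⟩ := key x
    · obtain ⟨P, hP, hP'⟩ := h.enters hL ht
      refine ⟨P, hP, fun z hz hzx => (hP' z hz).resolve_right ?_⟩
      rw [hzx]
      exact Ne.symm ht
    · exact enters_of_chain hL hu hw (hfu ▸ hn1 _) (hfw ▸ hn2 _)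
        (by rw [hfu, hfw]; exact (hn3 _).symm) ht
    · exact enters_of_chain hL hu hw (hfu ▸ hn2 _) (hfw ▸ hn1 _)
        (by rw [hfu, hfw]; exact hn3 _) ht
  have hstep : ∀ x, ∃ t ≠ f x, ∃ P, Enters H f L x t P ∧ ∀ z ∈ P, z = x ∨ f z = t := by
    intro x
    have hadj : ∀ u, H.Adj x u → f u ≠ f x →
        ∃ t ≠ f x, ∃ P, Enters H f L x t P ∧ ∀ z ∈ P, z = x ∨ f z = t := fun u hu h =>
      ⟨_, h, _, enters_step hL hu h, by simp⟩
    obtain h | ⟨-, u, w, hu, -, -, hfu, -⟩ | ⟨-, u, w, -, hu, -, -, -, hfu, -, -⟩ := key x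
    · exact ⟨_, hn1 _, h.enters hL (hn1 _)⟩
    · exact hadj u hu (hfu ▸ hn1 _)
    · exact hadj u hu (hfu ▸ hn2 _)
  intro x y hxy hf
  have hmixed : ∀ {x y u v}, x ≠ y → f x = f y → H.Adj x u → H.Adj y v → f u = f x + 1 →
      f v = f y - 1 → EntersTwice H f L x y := by
    intro x y u v hxy hf hu hv hfu hfv
    rw [← hf] at hfv
    refine entersTwice_of_adj hL hxy hf hu hv (hfu ▸ hn1 _) (hfv ▸ hn2 _) ?_
    rw [hfu, hfv]
    exact hn3 _
  obtain h | h | h := key x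
  · exact h.entersTwice hL hxy hf (hstep y)
  · obtain h' | h' | h' := key y
    · exact (h'.entersTwice hL hxy.symm hf.symm (hstep x)).symm hf.symm
    · obtain ⟨h0, u, w, hu, hw, -, hfu, hfw⟩ := h
      obtain ⟨h0', u', -, hu', -, -, hfu', -⟩ := h'
      rw [← hf] at hfu'
      refine entersTwice_of_chain hL hxy hf hu hw hu' (hfu' ▸ hn1 _) (hfw ▸ hn2 _) ?_ ?_ ?_ ?_
      · rw [hfw, hfu]; exact (hn3 _).symm
      · rw [hfw, hfu']; exact (hn3 _).symm
      -- A common neighbour would put two roots in one component.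
      · rintro rfl
        exact hxy (huniq x y (hu.reachable.trans hu'.symm.reachable) h0 h0')
      · rintro rfl
        exact hn1 _ (hfu.symm.trans hf.symm)
    · obtain ⟨-, u, -, hu, -, -, hfu, -⟩ := h
      obtain ⟨-, p, -, -, hp, -, -, -, hfp, -⟩ := h'
      exact hmixed hxy hf hu hp hfu hfp
  · obtain ⟨ht, p, g, q, hp, hg, hq, hqp, hfp, hfg, hq'⟩ := h
    obtain h' | h' | h' := key y
    · exact (h'.entersTwice hL hxy.symm hf.symm (hstep x)).symm hf.symm
    · obtain ⟨-, u, -, hu, -, -, hfu, -⟩ := h'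
      exact (hmixed hxy.symm hf.symm hu hp hfu hfp).symm hf.symm
    · obtain ⟨ht', p', g', -, hp', hg', -, -, hfp', hfg', -⟩ := h'
      have hpy : p ≠ y := by
        rintro rfl
        exact hn2 _ (hfp.symm.trans hf.symm)
      have hpx : p' ≠ x := by
        rintro rfl
        exact hn2 _ (hfp'.symm.trans hf)
      -- Both vertices have only lower neighbours. If they share the lower neighbour `p`, then `y`
      -- or `x` goes through `p`, and the other neighbour `q` of `x` serves the second path.
      by_cases hpp : p = p'
      · subst hpp
        obtain h | ⟨h, q', hq', hfq', hdq⟩ := hq'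
        · refine (entersTwice_of_chain hL hxy.symm hf.symm hp' hg hq ?_ ?_ ?_ ?_ hqp.symm hpx).symm
            hf.symm
          · rw [h, hf]; exact hn2 _
          · rw [hfg, hf]; exact hn1 _
          · rw [hfg, hfp]; exact hn3 _
          · rw [hfg, h]; exact hn3 _
        · have hqy : q ≠ y := by
            -- `q` lies below `x`, whereas all neighbours of `y` lie below `y`.
            rintro rfl
            have := ht' x hq.symm
            omega
          refine entersTwice_of_chain hL hxy hf hq hq' hp' ?_ ?_ ?_ ?_ hqp hqy
          · rw [hfp]; exact hn2 _
          · rw [hfq']; exact hn1 _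
          · rw [hfq', h]; exact hn1 _
          · rw [hfq', hfp]; exact hn3 _
      · rw [← hf] at hfp'
        refine entersTwice_of_chain hL hxy hf hp hg hp' ?_ ?_ ?_ ?_ hpp hpy
        · rw [hfp']; exact hn2 _
        · rw [hfg]; exact hn1 _
        · rw [hfg, hfp]; exact hn3 _
        · rw [hfg, hfp']; exact hn3 _

/-- Any at most three vertices can enter along disjoint paths with different legs. -/
theorem exists_entries (hL : ∀ x, L x (f x))
    (hone : ∀ x t, ∃ P, Enters H f L x t P ∧ ∀ z ∈ P, f z = f x → z = x)
    (htwo : ∀ x y, x ≠ y → f x = f y → EntersTwice H f L x y) (S : Finset W) (hS : S.card ≤ 3) :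
    ∃ l : List (ZMod 3 × Set W), (∀ p ∈ l, ∃ x, Enters H f L x p.1 p.2) ∧
      l.Pairwise (fun p q => p.1 ≠ q.1 ∧ Disjoint p.2 q.2) ∧ l.length ≤ S.card ∧
      ∀ x ∈ S, ∃ p ∈ l, x ∈ p.2 := by
  classical
  have hdir : ∀ x, Enters H f L x (f x) {x} := fun x => enters_leg (hL x)
  -- two vertices of equal colour and a third one
  have hpair : ∀ a b c : W, a ≠ b → a ≠ c → b ≠ c → f a = f b →
      ∃ l : List (ZMod 3 × Set W), (∀ p ∈ l, ∃ x, Enters H f L x p.1 p.2) ∧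
      l.Pairwise (fun p q => p.1 ≠ q.1 ∧ Disjoint p.2 q.2) ∧ l.length ≤ 3 ∧
      (∃ p ∈ l, a ∈ p.2) ∧ (∃ p ∈ l, b ∈ p.2) ∧ ∃ p ∈ l, c ∈ p.2 := by
    intro a b c hab hac hbc hf
    by_cases hc : f c = f a
    · obtain ⟨t₁, t₂, P, Q, hP, hQ, hdis, h12, h1, h2⟩ := htwo a b hab hf
      have ha := hP.mem
      have hb := hQ.mem
      -- All three colours agree: `a` and `b` leave the common colour to `c`, unless their paths
      -- already pass through `c`.
      by_cases hcP : c ∈ P ∨ c ∈ Q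
      · exact ⟨[(t₁, P), (t₂, Q)], by simpa using ⟨⟨a, hP⟩, b, hQ⟩, by simp [h12, hdis], by simp,
          by simp [ha], by simp [hb], by simpa using hcP⟩
      · push Not at hcP
        refine ⟨[(t₁, P), (t₂, Q), (f c, {c})], ?_, ?_, by simp, by simp [ha], by simp [hb],
          by simp⟩
        · simpa using ⟨⟨a, hP⟩, ⟨b, hQ⟩, c, hdir c⟩
        · simp [h12, hdis, hcP, hc, h1, h2]
    -- Only `a` is diverted, to the third colour; its path avoids `b`, which has the same colour as
    -- `a`.
    · obtain ⟨t, hta, htc⟩ : ∃ t, t ≠ f a ∧ t ≠ f c := by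
        generalize f a = α
        generalize f c = β
        clear * -
        decide +revert
      obtain ⟨P, hP, hP'⟩ := hone a t
      have ha := hP.mem
      have hbP : b ∉ P := fun h => hab (hP' b h hf.symm).symm
      by_cases hcP : c ∈ P
      · refine ⟨[(t, P), (f b, {b})], by simpa using ⟨⟨a, hP⟩, b, hdir b⟩, ?_, by simp,
          by simp [ha], by simp, by simp [hcP]⟩
        simp [hbP, ← hf, hta]
      · refine ⟨[(t, P), (f b, {b}), (f c, {c})], ?_, ?_, by simp,
          by simp [ha], by simp, by simp⟩
        · simpa using ⟨⟨a, hP⟩, ⟨b, hdir b⟩, c, hdir c⟩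
        · simp [hbP, hcP, ← hf, hta, htc, Ne.symm hc, hbc]
  obtain h0 | h1 | h2 | h3 : S.card = 0 ∨ S.card = 1 ∨ S.card = 2 ∨ S.card = 3 := by omega
  · rw [Finset.card_eq_zero] at h0
    subst h0
    exact ⟨[], by simp⟩
  · obtain ⟨a, rfl⟩ := Finset.card_eq_one.1 h1
    exact ⟨[(f a, {a})], by simpa using ⟨a, hdir a⟩, by simp⟩
  · obtain ⟨a, b, hab, rfl⟩ := Finset.card_eq_two.1 h2
    rw [h2]
    by_cases hf : f a = f b
    · obtain ⟨t₁, t₂, P, Q, hP, hQ, hdis, h12, -⟩ := htwo a b hab hf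
      exact ⟨[(t₁, P), (t₂, Q)], by simpa using ⟨⟨a, hP⟩, b, hQ⟩, by simp [h12, hdis], by simp,
        by simp [hP.mem, hQ.mem]⟩
    · exact ⟨[(f a, {a}), (f b, {b})], by simpa using ⟨⟨a, hdir a⟩, b, hdir b⟩,
        by simp [hf, hab], by simp, by simp⟩
  · obtain ⟨a, b, c, hab, hac, hbc, rfl⟩ := Finset.card_eq_three.1 h3
    rw [h3]
    by_cases h1 : f a = f b
    · obtain ⟨l, hl, hl', hlen, ha, hb, hc⟩ := hpair a b c hab hac hbc h1
      exact ⟨l, hl, hl', hlen, by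
        simpa only [Finset.mem_insert, Finset.mem_singleton, forall_eq_or_imp, forall_eq] using
          ⟨ha, hb, hc⟩⟩
    by_cases h2 : f a = f c
    · obtain ⟨l, hl, hl', hlen, ha, hb, hc⟩ := hpair a c b hac hab hbc.symm h2
      exact ⟨l, hl, hl', hlen, by
        simpa only [Finset.mem_insert, Finset.mem_singleton, forall_eq_or_imp, forall_eq] using
          ⟨ha, hc, hb⟩⟩
    by_cases h3 : f b = f c
    · obtain ⟨l, hl, hl', hlen, ha, hb, hc⟩ := hpair b c a hbc hab.symm hac.symm h3
      exact ⟨l, hl, hl', hlen, by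
        simpa only [Finset.mem_insert, Finset.mem_singleton, forall_eq_or_imp, forall_eq] using
          ⟨hc, ha, hb⟩⟩
    refine ⟨[(f a, {a}), (f b, {b}), (f c, {c})], ?_, ?_, by simp, by simp⟩
    · simpa using ⟨⟨a, hdir a⟩, ⟨b, hdir b⟩, c, hdir c⟩
    · simp [h1, h2, h3, hab, hac, hbc]

end Entries

/-! ### Colouring `G` and attaching the paths to a tree in `G[D]`. -/

section Attach

variable {V : Type u} {G : SimpleGraph V} {D : Set V} {K : Type v}
  {c : G.EdgeLabeling (K ⊕ ZMod 3)} {f : ↥Dᶜ → ZMod 3} {L : ↥Dᶜ → ZMod 3 → Prop}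

/-- A proper tree of `G` can be extended along an entry whose leg is available in the tree. -/
theorem Entry.exists_attach [Finite V]
    (hout : ∀ (x y : ↥Dᶜ) (h : G.Adj x y), c.get x y h = Sum.inr (-(f x + f y)))
    (hL : ∀ x t, L x t → ∃ y ∈ D, ∃ h : G.Adj x y, c.get x y h = Sum.inr t)
    {x : ↥Dᶜ} {e t : ZMod 3} {P : Set ↥Dᶜ} (hE : Entry (G.induce Dᶜ) f L x e t P) :
    ∃ y ∈ D, ∀ T : G.Subgraph, IsProperTree c T → y ∈ T.verts →
      (∀ z ∈ P, (z : V) ∉ T.verts) →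
      (∀ z ∈ D, ∀ w, ∀ h : T.Adj z w, c.get z w h.adj_sub ≠ Sum.inr t) →
      ∃ T' : G.Subgraph, IsProperTree c T' ∧ T'.verts = T.verts ∪ Subtype.val '' P ∧
        (∀ w (h : T'.Adj x w), c.get x w h.adj_sub = Sum.inr e) ∧
        ∀ z ∈ D, ∀ w (h : T'.Adj z w), T.Adj z w ∨ c.get z w h.adj_sub = Sum.inr t := by
  -- The foot `y` is fixed before `T`, since the tree in `G[D]` must be chosen to contain all feet.
  -- Recording the colour `e` at the start of the path lets it be prolonged; recording that only `t`
  -- is new at `D` lets further paths be attached.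
  induction hE with
  | @leg x t h =>
    obtain ⟨y, hy, hxy, hc⟩ := hL x t h
    refine ⟨y, hy, fun T hT hyT hP hD => ?_⟩
    have hxT : (x : V) ∉ T.verts := hP x rfl
    have hc' : c.get y x hxy.symm = Sum.inr t := by rw [EdgeLabeling.get_comm, hc]
    refine ⟨T ⊔ G.subgraphOfAdj hxy.symm,
      isProperTree_sup_subgraphOfAdj hT hyT hxT hxy.symm fun z hz => ?_, ?_, ?_, ?_⟩
    · rw [hc']
      exact hD y hy z hz
    · rw [Subgraph.verts_sup, subgraphOfAdj_verts]
      grind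
    · intro w hw
      obtain hw' | hw' := hw
      · exact absurd (T.edge_vert hw') hxT
      · rw [subgraphOfAdj_adj, Sym2.eq_iff] at hw'
        obtain ⟨h1, -⟩ | ⟨rfl, -⟩ := hw'
        · exact absurd h1 hxy.ne'
        · exact hc
    · intro z hz w hw
      obtain hw' | hw' := hw
      · exact Or.inl hw'
      · rw [subgraphOfAdj_adj, Sym2.eq_iff] at hw'
        obtain ⟨rfl, rfl⟩ | ⟨-, rfl⟩ := hw'
        · exact Or.inr hc'
        · exact absurd hz x.2
  | @step x y e t P h hy hx he ih =>
    obtain ⟨d, hd, ih⟩ := ih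
    have hxy : G.Adj x y := h
    refine ⟨d, hd, fun T hT hdT hP hD => ?_⟩
    obtain ⟨T', hT', hverts, hyT', hD'⟩ := ih T hT hdT (fun z hz => hP z (Or.inr hz)) hD
    have hyP : y ∈ P := Enters.mem ⟨_, hy⟩
    have hyV : (y : V) ∈ T'.verts := by
      rw [hverts]
      exact Or.inr ⟨y, hyP, rfl⟩
    have hxT' : (x : V) ∉ T'.verts := by
      rw [hverts]
      rintro (h' | ⟨z, hz, h'⟩)
      · exact hP x (Or.inl rfl) h'
      · exact hx (Subtype.ext h' ▸ hz)
    refine ⟨T' ⊔ G.subgraphOfAdj hxy.symm,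
      isProperTree_sup_subgraphOfAdj hT' hyV hxT' hxy.symm fun z hz => ?_, ?_, ?_, ?_⟩
    · rw [hyT' z hz, hout y x hxy.symm, add_comm]
      exact fun h' => he (Sum.inr_injective h').symm
    · rw [Subgraph.verts_sup, subgraphOfAdj_verts, hverts]
      grind
    · intro w hw
      obtain hw' | hw' := hw
      · exact absurd (T'.edge_vert hw') hxT'
      · rw [subgraphOfAdj_adj, Sym2.eq_iff] at hw'
        obtain ⟨h1, -⟩ | ⟨rfl, -⟩ := hw'
        · exact absurd h1 hxy.ne'
        · exact hout x y hxy
    · intro z hz w hw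
      obtain hw' | hw' := hw
      · exact hD' z hz w hw'
      · rw [subgraphOfAdj_adj, Sym2.eq_iff] at hw'
        obtain ⟨rfl, -⟩ | ⟨-, rfl⟩ := hw'
        · exact absurd hz y.2
        · exact absurd hz x.2

theorem exists_attach_list [Finite V]
    (hout : ∀ (x y : ↥Dᶜ) (h : G.Adj x y), c.get x y h = Sum.inr (-(f x + f y)))
    (hL : ∀ x t, L x t → ∃ y ∈ D, ∃ h : G.Adj x y, c.get x y h = Sum.inr t)
    (l : List (ZMod 3 × Set ↥Dᶜ)) (hl : ∀ p ∈ l, ∃ x, Enters (G.induce Dᶜ) f L x p.1 p.2)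
    (hpw : l.Pairwise fun p q => p.1 ≠ q.1 ∧ Disjoint p.2 q.2) :
    ∃ Y : Finset V, (Y : Set V) ⊆ D ∧ Y.card ≤ l.length ∧
      ∀ T : G.Subgraph, IsProperTree c T → (Y : Set V) ⊆ T.verts →
      (∀ p ∈ l, ∀ z ∈ p.2, (z : V) ∉ T.verts) →
      (∀ p ∈ l, ∀ z ∈ D, ∀ w, ∀ h : T.Adj z w, c.get z w h.adj_sub ≠ Sum.inr p.1) →
      ∃ T' : G.Subgraph, IsProperTree c T' ∧ T.verts ⊆ T'.verts ∧
        ∀ p ∈ l, ∀ z ∈ p.2, (z : V) ∈ T'.verts := by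
  classical
  induction l with
  | nil => exact ⟨∅, by simp, by simp, fun T hT _ _ _ => ⟨T, hT, le_rfl, by simp⟩⟩
  | cons p l ih =>
    rw [List.pairwise_cons] at hpw
    obtain ⟨Y, hYD, hYc, hY⟩ := ih (fun q hq => hl q (List.mem_cons_of_mem _ hq)) hpw.2
    obtain ⟨x, e, hx⟩ := hl p List.mem_cons_self
    obtain ⟨y, hyD, hy⟩ := hx.exists_attach hout hL
    refine ⟨insert y Y, ?_, (Finset.card_insert_le _ _).trans (by simpa using hYc), ?_⟩
    · rw [Finset.coe_insert]
      exact Set.insert_subset hyD hYD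
    intro T hT hYT hP hD
    rw [Finset.coe_insert, Set.insert_subset_iff] at hYT
    obtain ⟨T', hT', hverts, -, hadj⟩ := hy T hT hYT.1 (hP p List.mem_cons_self)
      (hD p List.mem_cons_self)
    have hsub : T.verts ⊆ T'.verts := by
      rw [hverts]
      exact Set.subset_union_left
    have hext := hY T' hT' (hYT.2.trans hsub) ?_ ?_
    · obtain ⟨T'', hT'', hsub', hl'⟩ := hext
      refine ⟨T'', hT'', hsub.trans hsub', fun q hq z hz => ?_⟩
      obtain rfl | hq := List.mem_cons.1 hq
      · apply hsub'
        rw [hverts]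
        exact Or.inr ⟨z, hz, rfl⟩
      · exact hl' q hq z hz
    · intro q hq z hz
      rw [hverts]
      rintro (h | ⟨z', hz', h⟩)
      · exact hP q (List.mem_cons_of_mem _ hq) z hz h
      · exact Set.disjoint_left.1 (hpw.1 q hq).2 hz' (Subtype.ext h ▸ hz)
    · intro q hq z hz w h
      obtain h' | h' := hadj z hz w h
      · exact hD q (List.mem_cons_of_mem _ hq) z hz w h'
      · rw [h']
        exact fun h'' => (hpw.1 q hq).1 (Sum.inr_injective h'')

/-- A choice of leg colours at a vertex outside a dominating set. -/
theorem exists_leg_coloring (hD : IsConnectedWayDominating 3 G D) (x : ↥Dᶜ) (a b : ZMod 3)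
    (hab : b ≠ a) : ∃ g : V → ZMod 3, (∃ y ∈ D, G.Adj x y ∧ g y = a) ∧
      ((∀ t, ∃ y ∈ D, G.Adj x y ∧ g y = t) ∨
        ((∃ y ∈ D, G.Adj x y ∧ g y = b) ∧ ∃ y, (G.induce Dᶜ).Adj x y) ∨
        ∃ y z, (G.induce Dᶜ).Adj x y ∧ (G.induce Dᶜ).Adj x z ∧ y ≠ z) := by
  classical
  obtain ⟨N, hN, hN3⟩ := Set.exists_subset_encard_eq (hD.degree_ge x x.2)
  obtain ⟨y₁, y₂, y₃, h12, h13, h23, rfl⟩ := Set.encard_eq_three.1 hN3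
  have h1 : G.Adj x y₁ := hN (by simp)
  have h2 : G.Adj x y₂ := hN (by simp)
  have h3 : G.Adj x y₃ := hN (by simp)
  have htwo : ∀ y z, G.Adj x y → G.Adj x z → y ≠ z → y ∉ D → z ∉ D →
      ∃ y z, (G.induce Dᶜ).Adj x y ∧ (G.induce Dᶜ).Adj x z ∧ y ≠ z :=
    fun y z hy hz hne hyD hzD =>
      ⟨⟨y, hyD⟩, ⟨z, hzD⟩, hy, hz, fun h => hne (congrArg Subtype.val h)⟩
  have hone : ∀ y z w, G.Adj x y → G.Adj x z → G.Adj x w → y ≠ z → y ∈ D → z ∈ D → w ∉ D →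
      ∃ g : V → ZMod 3, (∃ y ∈ D, G.Adj x y ∧ g y = a) ∧
        (∃ y ∈ D, G.Adj x y ∧ g y = b) ∧ ∃ y, (G.induce Dᶜ).Adj x y :=
    fun y z w hy hz hw hne hyD hzD hwD =>
      ⟨fun v => if v = y then a else b, ⟨y, hyD, hy, by simp⟩, ⟨z, hzD, hz, by simp [hne.symm]⟩,
        ⟨w, hwD⟩, hw⟩
  by_cases hpair : ∃ y z, (G.induce Dᶜ).Adj x y ∧ (G.induce Dᶜ).Adj x z ∧ y ≠ z
  · obtain ⟨y, hy, hxy⟩ := hD.dominating x x.2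
    exact ⟨fun _ => a, ⟨y, hy, hxy, rfl⟩, Or.inr (Or.inr hpair)⟩
  by_cases hsing : ∃ g : V → ZMod 3, (∃ y ∈ D, G.Adj x y ∧ g y = a) ∧
        (∃ y ∈ D, G.Adj x y ∧ g y = b) ∧ ∃ y, (G.induce Dᶜ).Adj x y
  · obtain ⟨g, hg, hg'⟩ := hsing
    exact ⟨g, hg, Or.inr (Or.inl hg')⟩
  -- Two of the three neighbours outside `D` give the third alternative, exactly one gives the
  -- second.
  have hd : y₁ ∈ D ∧ y₂ ∈ D ∧ y₃ ∈ D := by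
    by_contra hcon
    by_cases d1 : y₁ ∈ D <;> by_cases d2 : y₂ ∈ D <;> by_cases d3 : y₃ ∈ D
    · exact hcon ⟨d1, d2, d3⟩
    · exact hsing (hone y₁ y₂ y₃ h1 h2 h3 h12 d1 d2 d3)
    · exact hsing (hone y₁ y₃ y₂ h1 h3 h2 h13 d1 d3 d2)
    · exact hpair (htwo y₂ y₃ h2 h3 h23 d2 d3)
    · exact hsing (hone y₂ y₃ y₁ h2 h3 h1 h23 d2 d3 d1)
    · exact hpair (htwo y₁ y₃ h1 h3 h13 d1 d3)
    all_goals exact hpair (htwo y₁ y₂ h1 h2 h12 d1 d2)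
  -- For `a ≠ b` in `ZMod 3`, `-(a + b)` is the remaining colour.
  refine ⟨fun v => if v = y₁ then a else if v = y₂ then b else -(a + b),
    ⟨y₁, hd.1, h1, by simp⟩, Or.inl fun t => ?_⟩
  have ht : t = a ∨ t = b ∨ t = -(a + b) := by
    clear * - hab
    decide +revert
  obtain rfl | rfl | rfl := ht
  · exact ⟨y₁, hd.1, h1, by simp⟩
  · exact ⟨y₂, hd.2.1, h2, by simp [h12.symm]⟩
  · exact ⟨y₃, hd.2.2, h3, by simp [h13.symm, h23.symm]⟩

/-- Colour `G[D]` by `c₀`, the edges between `D` and its complement by `g` and the edges outside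
`D` by `f`. -/
noncomputable def extendLabeling (G : SimpleGraph V) (D : Set V)
    (c₀ : (G.induce D).EdgeLabeling K) (f : ↥Dᶜ → ZMod 3) (g : ↥Dᶜ → V → ZMod 3) :
    G.EdgeLabeling (K ⊕ ZMod 3) :=
  open Classical in
  EdgeLabeling.mk (fun x y h =>
    if hx : x ∈ D then
      if hy : y ∈ D then Sum.inl (c₀.get ⟨x, hx⟩ ⟨y, hy⟩ h) else Sum.inr (g ⟨y, hy⟩ x)
    else if hy : y ∈ D then Sum.inr (g ⟨x, hx⟩ y) else Sum.inr (-(f ⟨x, hx⟩ + f ⟨y, hy⟩)))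
    (by
      intro x y h
      by_cases hx : x ∈ D <;> by_cases hy : y ∈ D
      · simp only [hx, hy, dif_pos]
        exact congrArg Sum.inl (EdgeLabeling.get_comm (C := c₀) ⟨x, hx⟩ ⟨y, hy⟩ h.symm)
      · simp [hx, hy]
      · simp [hx, hy]
      · simp [hx, hy, add_comm])

theorem exists_properColoring_of_dominating [Finite V] (hD : IsConnectedWayDominating 3 G D)
    (c₀ : (G.induce D).EdgeLabeling K) (hc₀ : IsKProperColoring 3 c₀) :
    ∃ c : G.EdgeLabeling (K ⊕ ZMod 3), IsKProperColoring 3 c := by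
  classical
  obtain ⟨f, s, hs, hfs⟩ := exists_entry_coloring (G.induce Dᶜ)
  choose g hg hg' using fun x : ↥Dᶜ => exists_leg_coloring hD x (f x) (s x) (hs x)
  set c := extendLabeling G D c₀ f g with hc
  have hout : ∀ (x y : ↥Dᶜ) (h : G.Adj x y), c.get x y h = Sum.inr (-(f x + f y)) := by
    intro x y h
    have hx : (x : V) ∉ D := x.2
    have hy : (y : V) ∉ D := y.2
    rw [hc, extendLabeling, EdgeLabeling.get_mk, dif_neg hx, dif_neg hy]
  have hleg : ∀ (x : ↥Dᶜ) (y : V) (_ : y ∈ D) (h : G.Adj x y), c.get x y h = Sum.inr (g x y) := by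
    intro x y hy h
    have hx : (x : V) ∉ D := x.2
    rw [hc, extendLabeling, EdgeLabeling.get_mk, dif_neg hx, dif_pos hy]
  have hin : ∀ (x y : ↥D) (h : G.Adj x y), c.get x y h = Sum.inl (c₀.get x y h) := by
    intro x y h
    rw [hc, extendLabeling, EdgeLabeling.get_mk, dif_pos x.2, dif_pos y.2]
  obtain ⟨hone, htwo⟩ := hfs (fun x t => ∃ y ∈ D, G.Adj x y ∧ g x y = t) hg hg'
  refine ⟨c, fun S hS => ?_⟩
  have hcard : (S.filter (· ∈ D)).card + (S.subtype (· ∈ Dᶜ)).card = 3 := by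
    rw [Finset.card_subtype, ← hS]
    exact Finset.card_filter_add_card_filter_not _
  obtain ⟨l, hl, hpw, hlen, hcov⟩ := exists_entries hg hone htwo (S.subtype (· ∈ Dᶜ)) (by omega)
  obtain ⟨Y, hYD, hYc, hY⟩ := exists_attach_list hout
    (fun x t ⟨y, hy, h, ht⟩ => ⟨y, hy, h, ht ▸ hleg x y hy h⟩) l hl hpw
  -- The feet number at most the vertices of `S` outside `D`, so with those inside `D` there are at
  -- most three.
  have hsmall : ((S.filter (· ∈ D) ∪ Y).subtype (· ∈ D)).card ≤ 3 := by
    rw [Finset.card_subtype]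
    have := Finset.card_filter_le (S.filter (· ∈ D) ∪ Y) (· ∈ D)
    have := Finset.card_union_le (S.filter (· ∈ D)) Y
    omega
  obtain ⟨T₀, hST₀, hT₀, hp₀⟩ := exists_properTree_of_card_le hD.connected le_rfl hc₀ _ hsmall
  have hmem : ∀ x ∈ D, x ∈ S ∨ x ∈ Y → x ∈ (T₀.map (Embedding.induce D).toHom).verts :=
    fun x hx h => ⟨⟨x, hx⟩, hST₀ (by simpa [hx] using h), rfl⟩
  have hT₁ : IsProperTree c (T₀.map (Embedding.induce D).toHom) := by
    refine ⟨isTree_map_induce D T₀ hT₀, ?_⟩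
    rintro _ _ _ ⟨x, y, hy, rfl, rfl⟩ ⟨x', z, hz, hx, rfl⟩ hne
    obtain rfl : x' = x := Subtype.ext hx
    intro h
    have h' := (hin x' y hy.adj_sub).symm.trans (h.trans (hin x' z hz.adj_sub))
    exact hp₀ x' y z hy hz (fun h => hne (congrArg _ h)) (Sum.inl_injective h')
  have hext := hY _ hT₁ (fun y hy => hmem y (hYD hy) (Or.inr hy)) ?_ ?_
  · obtain ⟨T, hT, hsub, hlT⟩ := hext
    refine ⟨T, fun x hx => ?_, hT⟩
    by_cases hxD : x ∈ D
    · exact hsub (hmem x hxD (Or.inl hx))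
    · obtain ⟨p, hp, hxp⟩ := hcov ⟨x, hxD⟩ (by simpa using hx)
      exact hlT p hp _ hxp
  · rintro p - z - ⟨y, -, hy⟩
    exact z.2 (hy ▸ y.2)
  · rintro p - _ - _ ⟨x, y, hy, rfl, rfl⟩ h
    have h' := (hin x y hy.adj_sub).symm.trans h
    cases h'

theorem properIndex_le_of_dominating [Finite V] (hD : IsConnectedWayDominating 3 G D) :
    properIndex 3 G ≤ properIndex 3 (G.induce D) + 3 := by
  obtain ⟨c₀, hc₀⟩ := Nat.sInf_mem (exists_isKProperColoring 3 hD.connected)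
  obtain ⟨c, hc⟩ := exists_properColoring_of_dominating hD c₀ hc₀
  refine (properIndex_le_of_card hc).trans (le_of_eq ?_)
  rw [Fintype.card_sum, Fintype.card_fin, ZMod.card]
  rfl

end Attach

/-! ### Tightness: cliques glued at a vertex. -/

section Cliques

variable {p : ℕ} {i : Fin p → ℕ}

theorem cliqueUnion_adj_none (x : Σ j : Fin p, Fin (i j - 1)) :
    (cliqueUnion i).Adj (some x) none :=
  ⟨by simp, x.1, Or.inr ⟨x.2, rfl⟩, Or.inl rfl⟩

theorem cliqueUnion_connected : (cliqueUnion i).Connected := by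
  rw [connected_iff_exists_forall_reachable]
  refine ⟨none, fun x => ?_⟩
  cases x with
  | none => rfl
  | some x => exact (cliqueUnion_adj_none x).symm.reachable

/-- Two adjacent vertices other than the common one lie in the same clique. -/
theorem fst_eq_of_cliqueUnion_adj {x y : Σ j : Fin p, Fin (i j - 1)}
    (h : (cliqueUnion i).Adj (some x) (some y)) : x.1 = y.1 := by
  obtain ⟨-, j, hx, hy⟩ := h
  obtain hx | ⟨a, hx⟩ := hx
  · cases hx
  obtain hy | ⟨b, hy⟩ := hy
  · cases hy
  cases hx
  cases hy
  rfl

theorem isConnectedWayDominating_singleton (hi : ∀ j, 4 ≤ i j) :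
    IsConnectedWayDominating 3 (cliqueUnion i) {none} where
  dominating x hx := by
    obtain ⟨x, rfl⟩ := Option.ne_none_iff_exists'.1 hx
    exact ⟨none, rfl, cliqueUnion_adj_none x⟩
  degree_ge x hx := by
    obtain ⟨⟨j, a⟩, rfl⟩ := Option.ne_none_iff_exists'.1 hx
    have hj := hi j
    -- the clique of `x` without `x` itself
    let e : Fin (i j - 1) → CliqueUnionVertex i := fun b => if b = a then none else some ⟨j, b⟩
    have he : Function.Injective e := by
      intro b b' h
      simp only [e] at h
      split_ifs at h <;> simp_all
    have hsub : Set.range e ⊆ (cliqueUnion i).neighborSet (some ⟨j, a⟩) := by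
      rintro _ ⟨b, rfl⟩
      simp only [e]
      split_ifs with h
      · exact cliqueUnion_adj_none _
      · exact ⟨by simpa using Ne.symm h, j, Or.inr ⟨a, rfl⟩, Or.inr ⟨b, rfl⟩⟩
    refine le_trans ?_ (Set.encard_le_encard hsub)
    rw [← Set.image_univ, he.encard_image, Set.encard_univ]
    simp only [ENat.card_eq_coe_fintype_card, Fintype.card_fin]
    exact_mod_cast (by omega : 3 ≤ i j - 1)
  connected := by
    have : Nonempty ({none} : Set (CliqueUnionVertex i)) := ⟨⟨none, rfl⟩⟩
    exact ⟨.of_subsingleton⟩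

theorem properIndex_of_subsingleton {V : Type*} [Subsingleton V] (G : SimpleGraph V) :
    properIndex 3 G = 0 := by
  rw [properIndex, Nat.sInf_eq_zero]
  left
  have : IsEmpty G.edgeSet := by
    refine ⟨fun ⟨e, he⟩ => ?_⟩
    induction e with
    | _ x y => exact G.loopless.irrefl x (Subsingleton.elim y x ▸ he)
  refine ⟨fun e => isEmptyElim e, fun S hS => ?_⟩
  have := Finset.card_le_one_of_subsingleton S
  omega

/-- A connected subgraph which meets two of the cliques outside the common vertex contains an edge
from the common vertex to the first of these cliques. -/
theorem exists_adj_none {T : (cliqueUnion i).Subgraph} (hT : T.coe.Connected)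
    {x y : Σ j : Fin p, Fin (i j - 1)} (hx : some x ∈ T.verts) (hy : some y ∈ T.verts)
    (hxy : x.1 ≠ y.1) : ∃ a, T.Adj none (some ⟨x.1, a⟩) := by
  obtain ⟨w⟩ := hT.preconnected ⟨_, hx⟩ ⟨_, hy⟩
  -- Follow the walk to an edge leaving the clique of `x` minus the common vertex; such an edge can
  -- only end at the common vertex.
  obtain ⟨d, -, h1, h2⟩ := w.exists_boundary_dart
    {z | ∃ a, (z : CliqueUnionVertex i) = some ⟨x.1, a⟩} ⟨x.2, rfl⟩ (by
      rintro ⟨a, ha⟩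
      have := congrArg Sigma.fst (Option.some_injective _ ha)
      exact hxy this.symm)
  obtain ⟨a, ha⟩ := h1
  have hadj : T.Adj d.fst d.snd := d.adj
  rw [ha] at hadj
  refine ⟨a, ?_⟩
  cases hz : (d.snd : CliqueUnionVertex i) with
  | none => exact (hz ▸ hadj).symm
  | some z =>
    rw [hz] at hadj
    have hfst : x.1 = z.1 := fst_eq_of_cliqueUnion_adj (x := ⟨x.1, a⟩) hadj.adj_sub
    refine absurd ⟨hfst ▸ z.2, ?_⟩ h2
    rw [hz]
    obtain ⟨j, b⟩ := z
    obtain ⟨j', b'⟩ := x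
    simp only at hfst
    subst hfst
    rfl

theorem three_le_properIndex_cliqueUnion (hp : 3 ≤ p) (hi : ∀ j, 4 ≤ i j) :
    3 ≤ properIndex 3 (cliqueUnion i) := by
  classical
  suffices ∀ t : ℕ, (∃ c : (cliqueUnion i).EdgeLabeling (Fin t), IsKProperColoring 3 c) → 3 ≤ t from
    this _ (Nat.sInf_mem (exists_isKProperColoring 3 cliqueUnion_connected))
  rintro t ⟨c, hc⟩
  let v : Fin 3 → Σ j : Fin p, Fin (i j - 1) := fun k =>
    ⟨Fin.castLE hp k, ⟨0, by have := hi (Fin.castLE hp k); omega⟩⟩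
  have hv : ∀ k k', k ≠ k' → (v k).1 ≠ (v k').1 := fun k k' h h' => h (Fin.castLE_injective hp h')
  have hinj : Function.Injective fun k => some (v k) := fun k k' h => by
    by_contra hne
    exact hv k k' hne (congrArg Sigma.fst (Option.some_injective _ h))
  obtain ⟨T, hST, hT, hprop⟩ := hc (Finset.univ.image fun k => some (v k))
    (by rw [Finset.card_image_of_injective _ hinj]; rfl)
  have hmem : ∀ k, some (v k) ∈ T.verts := fun k => hST (by simp)
  have hadj : ∀ k, ∃ a, T.Adj none (some ⟨(v k).1, a⟩) := fun k => by
    obtain ⟨k', hk'⟩ := exists_ne k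
    exact exists_adj_none hT.1 (hmem k) (hmem k') (hv k k' hk'.symm)
  choose a ha using hadj
  -- The three tree edges at the common vertex lead to different cliques, so they are distinct and
  -- adjacent.
  have hcol : Function.Injective fun k => c.get _ _ (ha k).adj_sub := by
    intro k k' h
    by_contra hne
    refine hprop none _ _ (ha k) (ha k') (fun h' => ?_) h
    exact hv k k' hne (Sigma.mk.inj_iff.1 (Option.some.inj h')).1
  simpa using Fintype.card_le_of_injective _ hcol

end Cliques

end ProperIndex

theorem theorem3p1 :
    (∀ (V : Type*) [Finite V] (G : SimpleGraph V) (D : Set V), G.Connected →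
      ProperIndex.IsConnectedWayDominating 3 G D →
      ProperIndex.properIndex 3 G ≤ ProperIndex.properIndex 3 (G.induce D) + 3) ∧
    (∀ (p : ℕ) (i : Fin p → ℕ), 3 ≤ p → (∀ j, 4 ≤ i j) →
      (ProperIndex.cliqueUnion i).Connected ∧
      ProperIndex.IsConnectedWayDominating 3 (ProperIndex.cliqueUnion i) {none} ∧
      ProperIndex.properIndex 3 ((ProperIndex.cliqueUnion i).induce {none}) = 0 ∧
      ProperIndex.properIndex 3 (ProperIndex.cliqueUnion i) = 3) := by
  refine ⟨fun V _ G D _ hD => ProperIndex.properIndex_le_of_dominating hD, fun p i hp hi => ?_⟩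
  have hD := ProperIndex.isConnectedWayDominating_singleton hi
  have h0 : ProperIndex.properIndex 3 ((ProperIndex.cliqueUnion i).induce {none}) = 0 :=
    ProperIndex.properIndex_of_subsingleton _
  refine ⟨ProperIndex.cliqueUnion_connected, hD, h0, le_antisymm ?_
    (ProperIndex.three_le_properIndex_cliqueUnion hp hi)⟩
  -- The upper bound is the first half applied to the common vertex as dominating set.
  exact (ProperIndex.properIndex_le_of_dominating hD).trans_eq (by rw [h0])
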